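/- Let $\Delta_\Theta\subset\mathbb R^3$ be the tetrahedron $$0\le t_k\le 1\ (k=1,2,3),\qquad |t_1-t_2|\le t_3\le \min(t_1+t_2,\;2-t_1-t_2).$$ Let $3\Theta$ be the trivalent graph of genus 3 formed by a vertical oval crossed by two horizontal strings. It has vertices $v_1,v_2$ on the left (top, bottom), and their mirror images $v_1',v_2'$ on the right. Its six edges are: for $i=1,2$ an edge $a_i$ (the top arc of the oval for $i=1$, the bottom arc for $i=2$) and an edge $b_i$ (a horizontal string), both joining $v_i$ to $v_i'$; the left arc $e_1$ joining $v_1$ to $v_2$; and the right arc $e_1'$ joining $v_1'$ to $v_2'$. Let $\Sigma$ be the closed oriented surface of genus 3 obtained by pumping up $3\Theta$ (each vertex becomes a trinion, i.e. a sphere with three discs removed, and each edge $e$ becomes a circle $C_e$ along which two trinions are glued). Let $\operatorname{ClRep}(\pi_1(\Sigma))$ be the set of conjugacy classes of representations $\pi_1(\Sigma)\to \mathrm{SU}(2)$, with the Goldman functions $c_e([\rho])=\frac1\pi\cos^{-1}\bigl(\frac12\operatorname{Tr}\rho([C_e])\bigr)$. Take $V_+=\{v_1,v_2'\}$. Every edge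 has exactly one end in $V_+$, so the six edges are indexed by coordinates on $\mathbb R^6=\mathbb R^3_1\times\mathbb R^3_2$: $t_1^i,t_2^i$ belong to $a_i,b_i$ for $i=1,2$, while $t_3^1$ belongs to $e_1$ and $t_3^2$ belongs to $e_1'$. Let $\Delta_{3\Theta}\subset\mathbb R^6$ be the moment polytope, i.e. the image of $\operatorname{ClRep}(\pi_1(\Sigma))$ under $(c_e)_e$. Say that $t=(t^1,t^2)\in(\Delta_\Theta)^2$ satisfies the *gluing constraints* if one can choose for each of the four trinions a point of the tetrahedron $\Delta_\Theta$ (its coordinates being indexed by the three boundary circles), equal to $t^1$ at $v_1$ and to $t^2$ at $v_2'$, so that the coordinates of the two trinions adjacent to each edge are equal. **Proposition.** $\Delta_{3\Theta}\subset(\Delta_\Theta)^2$, and for $t=(t^1,t^2)\in(\Delta_\Theta)^2$ the following are equivalent: 1. $t\in\Delta_{3\Theta}$; 2. $t$ satisfies the gluing constraints; 3. $t$ satisfies the crossed inequalities $$|t_1^i-t_2^i|\le t_3^j\le \min(t_1^i+t_2^i,\;2-t_1^i-t_2^i)\quad\text{for } i\ne j,\ i,j\in\{1,2\}.$$ -/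

import Mathlib

noncomputable section

namespace Delzant

/-- The group `SU(2)`. -/
abbrev SU2 : Type := Matrix.specialUnitaryGroup (Fin 2) ℂ

/-! ### Classes of `SU(2)`-representations and Goldman functions -/

/-- Two representations are equivalent when they are conjugate by an element of `SU(2)`. -/
def conjSetoid (π : Type) [Group π] : Setoid (π →* SU2) where
  r ρ₁ ρ₂ := ∃ g : SU2, ∀ x, ρ₂ x = g * ρ₁ x * g⁻¹
  iseqv :=
    { refl := fun ρ => ⟨1, fun x => by simp⟩
      symm := by
        rintro ρ₁ ρ₂ ⟨g, hg⟩
        exact ⟨g⁻¹, fun x => by rw [hg x]; group⟩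
      trans := by
        rintro ρ₁ ρ₂ ρ₃ ⟨g, hg⟩ ⟨h, hh⟩
        exact ⟨h * g, fun x => by rw [hh x, hg x]; group⟩ }

/-- The space of classes of representations `π → SU(2)`. -/
def ClRep (π : Type) [Group π] : Type := Quotient (conjSetoid π)

/-- `(1/π) arccos (Tr A / 2)`; the trace of an element of `SU(2)` is real. -/
def angle (A : SU2) : ℝ :=
  1 / Real.pi * Real.arccos (1 / 2 * (Matrix.trace (A : Matrix (Fin 2) (Fin 2) ℂ)).re)

theorem angle_conj (g A : SU2) : angle (g * A * g⁻¹) = angle A := by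
  have h : Matrix.trace ((g * A * g⁻¹ : SU2) : Matrix (Fin 2) (Fin 2) ℂ)
      = Matrix.trace (A : Matrix (Fin 2) (Fin 2) ℂ) := by
    have h1 : ((g * A * g⁻¹ : SU2) : Matrix (Fin 2) (Fin 2) ℂ)
        = ((g * A : SU2) : Matrix (Fin 2) (Fin 2) ℂ) * ((g⁻¹ : SU2) : Matrix _ _ ℂ) := rfl
    have h2 : ((g⁻¹ * (g * A) : SU2) : Matrix (Fin 2) (Fin 2) ℂ)
        = ((g⁻¹ : SU2) : Matrix _ _ ℂ) * ((g * A : SU2) : Matrix (Fin 2) (Fin 2) ℂ) := rfl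
    rw [h1, Matrix.trace_mul_comm, ← h2, inv_mul_cancel_left]
  rw [angle, angle, h]

/-- The Goldman function of the (free homotopy class of the) closed curve `γ`. -/
def goldman {π : Type} [Group π] (γ : π) : ClRep π → ℝ :=
  Quotient.lift (s := conjSetoid π) (fun ρ => angle (ρ γ)) (by
    rintro ρ₁ ρ₂ ⟨g, hg⟩
    show angle (ρ₁ γ) = angle (ρ₂ γ)
    rw [hg γ, angle_conj])

/-! ### Trivalent graphs and the surfaces they define -/

/-- A trivalent graph with vertex set `V`: the three half-edges at each vertex are numbered
by `Fin 3`, and the edges are the orbits of a fixed-point-free involution on half-edges. -/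
structure TrivalentGraph (V : Type) where
  opp : V × Fin 3 → V × Fin 3
  opp_opp : ∀ h, opp (opp h) = h
  opp_ne : ∀ h, opp h ≠ h

/-- Generators for the fundamental group of the surface `Σ_Γ`. For a half-edge `h = (v, k)`,
`bdry h` is the `k`-th boundary circle of the trinion of `v`, with the boundary orientation and
joined to the base point of this trinion; `cross h` is the path from that base point, through this
circle, to the base point of the neighbouring trinion. -/
inductive SurfaceGen (V : Type) : Type
  | bdry (h : V × Fin 3)
  | cross (h : V × Fin 3)

open SurfaceGen in
/-- Defining relations of `π₁(Σ_Γ)` (Seifert–van Kampen for the decomposition of `Σ_Γ` into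
trinions): the product of the three boundary loops of a trinion is trivial; crossing an edge
backwards is the inverse of crossing it; the two trinions at an edge induce opposite orientations
on the common circle; and the edges of the spanning tree `T` are used to join the base points. -/
inductive SurfaceRel {V : Type} (Γ : TrivalentGraph V) (T : Set (V × Fin 3)) :
    FreeGroup (SurfaceGen V) → Prop
  | trinion (v : V) : SurfaceRel Γ T
      (FreeGroup.of (bdry (v, 0)) * FreeGroup.of (bdry (v, 1)) * FreeGroup.of (bdry (v, 2)))
  | back (h : V × Fin 3) : SurfaceRel Γ T
      (FreeGroup.of (cross h) * FreeGroup.of (cross (Γ.opp h)))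
  | glue (h : V × Fin 3) : SurfaceRel Γ T
      (FreeGroup.of (bdry h) * (FreeGroup.of (cross h) * FreeGroup.of (bdry (Γ.opp h)) *
        (FreeGroup.of (cross h))⁻¹))
  | tree (h : V × Fin 3) (hT : h ∈ T) : SurfaceRel Γ T (FreeGroup.of (cross h))

/-- The fundamental group of the surface `Σ_Γ` obtained by pumping up the connected trivalent
graph `Γ`, presented by means of a spanning tree `T` (given as its set of half-edges). -/
abbrev SurfaceGroup {V : Type} (Γ : TrivalentGraph V) (T : Set (V × Fin 3)) : Type :=
  PresentedGroup {r | SurfaceRel Γ T r}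

/-- The meridian circle `C_e`, as an element of `π₁(Σ_Γ)`, for the edge `e` containing the
half-edge `h` (up to conjugation and inversion it depends on `e` only). -/
def meridian {V : Type} (Γ : TrivalentGraph V) (T : Set (V × Fin 3)) (h : V × Fin 3) :
    SurfaceGroup Γ T :=
  PresentedGroup.of (SurfaceGen.bdry h)

/-! ### The multi-theta graph of genus three -/

/-- Vertices of the oval crossed by two horizontal strings: the first component is the side
(`false` is left, `true` is right), the second is the string, from top to bottom. -/
abbrev Vert : Type := Bool × Fin 2

/-- Half-edges at a vertex: `0` is the arc closing up the oval (at the top or the bottom), `1` is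
the horizontal string, `2` is the arc of the oval running vertically to the other string. -/
def thetaOpp : Vert × Fin 3 → Vert × Fin 3
  | ((s, i), 0) => ((!s, i), 0)
  | ((s, i), 1) => ((!s, i), 1)
  | ((s, i), 2) => ((s, Fin.rev i), 2)

/-- The multi-theta graph `3Θ`. -/
def threeTheta : TrivalentGraph Vert where
  opp := thetaOpp
  opp_opp := by decide
  opp_ne := by decide

/-- A spanning tree of `3Θ`: the two strings and the left vertical arc. -/
def thetaTree : Set (Vert × Fin 3) :=
  {h | h.2 = 1 ∨ (h.1.1 = false ∧ h.2 = 2)}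

/-- The half `V₊ = {v₁, i₀(v₂)}` of the vertices: top left and bottom right. -/
def vplus : Fin 2 → Vert := ![(false, 0), (true, 1)]

/-- Every edge of `3Θ` has exactly one end in `V₊`, so the six edges are the half-edges
`(vplus i, k)`, and `(t i k)` are coordinates on `ℝ⁶ = ℝ³ × ℝ³` indexed by the edges. -/
theorem existsUnique_vplus (h : Vert × Fin 3) :
    ∃! q : Fin 2 × Fin 3, (vplus q.1, q.2) = h ∨ threeTheta.opp (vplus q.1, q.2) = h := by
  unfold ExistsUnique threeTheta vplus
  revert h
  decide

/-- The moment map `c_{3Θ} : ClRep(π₁(Σ)) → ℝ³ × ℝ³`; `momentMap ρ i k` is the coordinate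
`t_{k+1}^{i+1}`, the Goldman function of the `k`-th edge at the `i`-th vertex of `V₊`. -/
def momentMap (ρ : ClRep (SurfaceGroup threeTheta thetaTree)) : Fin 2 → Fin 3 → ℝ :=
  fun i k => goldman (meridian threeTheta thetaTree (vplus i, k)) ρ

/-- The moment polytope `Δ_{3Θ}`: the image of the moment map. -/
def momentPolytope : Set (Fin 2 → Fin 3 → ℝ) := Set.range momentMap

/-! ### The tetrahedron, the gluing constraints and the crossed inequalities -/

/-- The tetrahedron `Δ_Θ`. -/
def tetrahedron : Set (Fin 3 → ℝ) :=
  {t | (∀ k, 0 ≤ t k ∧ t k ≤ 1) ∧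
    |t 0 - t 1| ≤ t 2 ∧ t 2 ≤ min (t 0 + t 1) (2 - t 0 - t 1)}

/-- The polytope `(Δ_Θ)²`. -/
def tetrahedronSq : Set (Fin 2 → Fin 3 → ℝ) := {t | ∀ i, t i ∈ tetrahedron}

/-- The gluing constraints on `t`: there are points of the tetrahedra of all four trinions of
`Σ_{3Θ}` whose coordinates agree along every edge, and which are given by `t` at `V₊`. -/
def GluingConstraints (t : Fin 2 → Fin 3 → ℝ) : Prop :=
  ∃ p : Vert → Fin 3 → ℝ,
    (∀ v, p v ∈ tetrahedron) ∧
    (∀ h : Vert × Fin 3, p (threeTheta.opp h).1 (threeTheta.opp h).2 = p h.1 h.2) ∧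
    ∀ i, p (vplus i) = t i

/-- The crossed inequalities
`|t₁ⁱ - t₂ⁱ| ≤ t₃ʲ ≤ min (t₁ⁱ + t₂ⁱ) (2 - t₁ⁱ - t₂ⁱ)` for `i ≠ j`. -/
def CrossedInequalities (t : Fin 2 → Fin 3 → ℝ) : Prop :=
  ∀ i j : Fin 2, i ≠ j →
    |t i 0 - t i 1| ≤ t j 2 ∧ t j 2 ≤ min (t i 0 + t i 1) (2 - t i 0 - t i 1)

end Delzant

end

/-! The argument is local at the trinions. Identify `SU2` with the unit quaternions, so that π times
the `angle` is the angle to 1. By Cauchy–Schwarz, the angles of three elements with product 1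
satisfy the inequalities of the tetrahedron (`angle_mem_tetrahedron`), and every point of the
tetrahedron arises this way (`exists_angle_eq_of_mem_tetrahedron`).

The angle determines the conjugacy class and is invariant under inversion. Hence trinion
representations with equal angles along each edge can always be glued: the gluing elements are
chosen edge by edge, then normalized to 1 along the tree (`exists_rep_of_labelling`). So the moment
polytope is cut out by the gluing constraints.

For `3Θ` the pair `t` already labels all six edges. The only new conditions are those at the two
vertices outside `vplus`, and they are the crossed inequalities. -/

namespace Delzant

open Matrix

/-! ### Quaternionic coordinates on `SU(2)` -/

/-- The matrix of the quaternion `x + y i + z j + w k`. -/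
def quatMatrix (x y z w : ℝ) : Matrix (Fin 2) (Fin 2) ℂ :=
  !![⟨x, y⟩, ⟨z, w⟩; ⟨-z, w⟩, ⟨x, -y⟩]

theorem quatMatrix_mul (a b c d x y z w : ℝ) :
    quatMatrix a b c d * quatMatrix x y z w =
      quatMatrix (a * x - b * y - c * z - d * w) (a * y + b * x + c * w - d * z)
        (a * z - b * w + c * x + d * y) (a * w + b * z - c * y + d * x) := by
  ext i j
  fin_cases i <;> fin_cases j <;> apply Complex.ext <;>
    simp [quatMatrix, Matrix.mul_apply, Fin.sum_univ_two] <;> ring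

theorem quatMatrix_mem {x y z w : ℝ} (h : x ^ 2 + y ^ 2 + z ^ 2 + w ^ 2 = 1) :
    quatMatrix x y z w ∈ specialUnitaryGroup (Fin 2) ℂ := by
  rw [mem_specialUnitaryGroup_iff, mem_unitaryGroup_iff]
  constructor
  · have hs : star (quatMatrix x y z w) = quatMatrix x (-y) (-z) (-w) := by
      ext i j
      fin_cases i <;> fin_cases j <;> apply Complex.ext <;>
        simp [quatMatrix, Matrix.star_apply]
    rw [hs, quatMatrix_mul]
    ext i j
    fin_cases i <;> fin_cases j <;> apply Complex.ext <;> simp [quatMatrix] <;> linarith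
  · rw [quatMatrix, det_fin_two_of]
    apply Complex.ext <;> simp <;> linarith

/-- The element of `SU(2)` given by a unit quaternion. -/
def quat (x y z w : ℝ) (h : x ^ 2 + y ^ 2 + z ^ 2 + w ^ 2 = 1) : SU2 :=
  ⟨quatMatrix x y z w, quatMatrix_mem h⟩

/-- In determinant 1 the inverse is the adjugate, and unitarity makes it the conjugate transpose;
comparing entries gives the quaternion form. -/
theorem exists_eq_quat (A : SU2) : ∃ x y z w h, A = quat x y z w h := by
  obtain ⟨A, hA⟩ := A
  have hA' := mem_specialUnitaryGroup_iff.1 hA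
  have hinv : star A = adjugate A := by
    calc star A = star A * (A * adjugate A) := by rw [mul_adjugate, hA'.2]; simp
      _ = adjugate A := by
        rw [← mul_assoc, mem_unitaryGroup_iff'.1 hA'.1, one_mul]
  have h00 := congrFun (congrFun hinv 0) 0
  have h01 := congrFun (congrFun hinv 1) 0
  have hd := hA'.2
  rw [adjugate_fin_two] at h00 h01
  simp only [Matrix.star_apply] at h00 h01
  have e11 : A 1 1 = ⟨(A 0 0).re, -(A 0 0).im⟩ := h00.symm
  have e10 : A 1 0 = ⟨-(A 0 1).re, (A 0 1).im⟩ := by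
    have : A 1 0 = -star (A 0 1) := by rw [h01]; simp
    rw [this]; apply Complex.ext <;> simp
  rw [det_fin_two, e11, e10] at hd
  have hre := congrArg Complex.re hd
  simp at hre
  refine ⟨(A 0 0).re, (A 0 0).im, (A 0 1).re, (A 0 1).im, by linarith, Subtype.ext ?_⟩
  ext i j
  fin_cases i <;> fin_cases j <;> simp [quat, quatMatrix, e11, e10]

theorem quat_mul (a b c d x y z w : ℝ) (h h') :
    quat a b c d h * quat x y z w h' =
      quat (a * x - b * y - c * z - d * w) (a * y + b * x + c * w - d * z)
        (a * z - b * w + c * x + d * y) (a * w + b * z - c * y + d * x) (by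
          linear_combination (x ^ 2 + y ^ 2 + z ^ 2 + w ^ 2) * h + h') :=
  Subtype.ext (quatMatrix_mul ..)

theorem angle_quat (x y z w : ℝ) (h) : angle (quat x y z w h) = Real.arccos x / Real.pi := by
  simp [angle, quat, quatMatrix, Matrix.trace_fin_two, div_eq_inv_mul]
  ring_nf

theorem quat_inv (x y z w : ℝ) (h) :
    (quat x y z w h)⁻¹ = quat x (-y) (-z) (-w) (by linarith) := by
  rw [inv_eq_iff_mul_eq_one, quat_mul]
  apply Subtype.ext
  ext i j
  fin_cases i <;> fin_cases j <;> apply Complex.ext <;> simp [quat, quatMatrix] <;> linarith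

theorem angle_inv (A : SU2) : angle A⁻¹ = angle A := by
  obtain ⟨x, y, z, w, h, rfl⟩ := exists_eq_quat A
  rw [quat_inv, angle_quat, angle_quat]

theorem angle_nonneg (A : SU2) : 0 ≤ angle A :=
  mul_nonneg (by positivity) (Real.arccos_nonneg _)

theorem angle_le_one (A : SU2) : angle A ≤ 1 := by
  rw [angle, one_div, inv_mul_le_iff₀ Real.pi_pos, mul_one]
  exact Real.arccos_le_pi _

/-! ### Conjugacy classes of `SU(2)` -/

/-- A nonzero imaginary intertwiner, rescaled to norm 1, lies in `SU2`; the scalar cancels. -/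
theorem exists_conj_of_commute_quatMatrix {a b c d a' b' c' d' : ℝ} {h h'} {y z w : ℝ}
    (hne : 0 < y ^ 2 + z ^ 2 + w ^ 2)
    (hc : quatMatrix a b c d * quatMatrix 0 y z w =
      quatMatrix 0 y z w * quatMatrix a' b' c' d') :
    ∃ X : SU2, quat a b c d h = X * quat a' b' c' d' h' * X⁻¹ := by
  set r := √(y ^ 2 + z ^ 2 + w ^ 2)
  have hr2 : r ^ 2 = y ^ 2 + z ^ 2 + w ^ 2 := Real.sq_sqrt hne.le
  have hr0 : r ≠ 0 := (Real.sqrt_pos.2 hne).ne'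
  have hX : (0 : ℝ) ^ 2 + (y / r) ^ 2 + (z / r) ^ 2 + (w / r) ^ 2 = 1 := by
    field_simp
    linarith
  have hs : quatMatrix 0 (y / r) (z / r) (w / r) = ((r⁻¹ : ℝ) : ℂ) • quatMatrix 0 y z w := by
    ext i j
    fin_cases i <;> fin_cases j <;> apply Complex.ext <;>
      simp [quatMatrix] <;> ring
  refine ⟨quat 0 (y / r) (z / r) (w / r) hX, ?_⟩
  rw [eq_mul_inv_iff_mul_eq]
  apply Subtype.ext
  change quatMatrix a b c d * quatMatrix 0 (y / r) (z / r) (w / r) =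
    quatMatrix 0 (y / r) (z / r) (w / r) * quatMatrix a' b' c' d'
  rw [hs, Matrix.mul_smul, Matrix.smul_mul, hc]

theorem exists_conj_of_angle_eq {A B : SU2} (hAB : angle A = angle B) :
    ∃ X : SU2, A = X * B * X⁻¹ := by
  obtain ⟨a, b, c, d, h, rfl⟩ := exists_eq_quat A
  obtain ⟨a', b', c', d', h', rfl⟩ := exists_eq_quat B
  rw [angle_quat, angle_quat, div_left_inj' Real.pi_ne_zero] at hAB
  have ha : a = a' := Real.arccos_injOn
    ⟨by nlinarith [sq_nonneg b, sq_nonneg c, sq_nonneg d],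
      by nlinarith [sq_nonneg b, sq_nonneg c, sq_nonneg d]⟩
    ⟨by nlinarith [sq_nonneg b', sq_nonneg c', sq_nonneg d'],
      by nlinarith [sq_nonneg b', sq_nonneg c', sq_nonneg d']⟩ hAB
  subst ha
  -- The imaginary parts v, v' have equal length, so v² = v'² and v + v' intertwines the two
  -- quaternions. If v' = -v, any nonzero imaginary quaternion orthogonal to v anticommutes with v
  -- and serves instead.
  by_cases hs : 0 < (b + b') ^ 2 + (c + c') ^ 2 + (d + d') ^ 2
  · refine exists_conj_of_commute_quatMatrix hs ?_
    rw [quatMatrix_mul, quatMatrix_mul]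
    congr 1 <;> linarith
  · have hb : b' = -b := by nlinarith [sq_nonneg (b + b'), sq_nonneg (c + c'), sq_nonneg (d + d')]
    have hc : c' = -c := by nlinarith [sq_nonneg (b + b'), sq_nonneg (c + c'), sq_nonneg (d + d')]
    have hd : d' = -d := by nlinarith [sq_nonneg (b + b'), sq_nonneg (c + c'), sq_nonneg (d + d')]
    subst hb hc hd
    by_cases h0 : 0 < c ^ 2 + (-b) ^ 2 + (0 : ℝ) ^ 2
    · refine exists_conj_of_commute_quatMatrix h0 ?_
      rw [quatMatrix_mul, quatMatrix_mul]
      congr 1 <;> ring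
    · have hb : b = 0 := by nlinarith [sq_nonneg b, sq_nonneg c]
      have hc : c = 0 := by nlinarith [sq_nonneg b, sq_nonneg c]
      subst hb hc
      refine exists_conj_of_commute_quatMatrix (y := 1) (z := 0) (w := 0) (by norm_num) ?_
      rw [quatMatrix_mul, quatMatrix_mul]
      congr 1 <;> ring

/-! ### Representations of the trinion group -/

theorem angle_mem_tetrahedron {f : Fin 3 → SU2} (hf : f 0 * f 1 * f 2 = 1) :
    (fun k => angle (f k)) ∈ tetrahedron := by
  refine ⟨fun k => ⟨angle_nonneg _, angle_le_one _⟩, ?_⟩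
  have h2 : angle (f 2) = angle (f 0 * f 1) := by rw [eq_inv_of_mul_eq_one_right hf, angle_inv]
  simp only [h2]
  obtain ⟨a, b, c, d, h, hA⟩ := exists_eq_quat (f 0)
  obtain ⟨a', b', c', d', h', hB⟩ := exists_eq_quat (f 1)
  rw [hA, hB, quat_mul, angle_quat, angle_quat, angle_quat]
  set α := Real.arccos a
  set β := Real.arccos a'
  set e := a * a' - b * b' - c * c' - d * d'
  have hcα : Real.cos α = a := Real.cos_arccos
    (by nlinarith [sq_nonneg b, sq_nonneg c, sq_nonneg d])
    (by nlinarith [sq_nonneg b, sq_nonneg c, sq_nonneg d])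
  have hcβ : Real.cos β = a' := Real.cos_arccos
    (by nlinarith [sq_nonneg b', sq_nonneg c', sq_nonneg d'])
    (by nlinarith [sq_nonneg b', sq_nonneg c', sq_nonneg d'])
  have hα0 : 0 ≤ α := Real.arccos_nonneg _
  have hβ0 : 0 ≤ β := Real.arccos_nonneg _
  have hαπ : α ≤ Real.pi := Real.arccos_le_pi _
  have hβπ : β ≤ Real.pi := Real.arccos_le_pi _
  have hss : 0 ≤ Real.sin α * Real.sin β :=
    mul_nonneg (Real.sin_nonneg_of_nonneg_of_le_pi hα0 hαπ)
      (Real.sin_nonneg_of_nonneg_of_le_pi hβ0 hβπ)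
  have hsα : Real.sin α ^ 2 = b ^ 2 + c ^ 2 + d ^ 2 := by rw [Real.sin_sq, hcα]; linarith
  have hsβ : Real.sin β ^ 2 = b' ^ 2 + c' ^ 2 + d' ^ 2 := by rw [Real.sin_sq, hcβ]; linarith
  -- Cauchy–Schwarz for the imaginary parts, via Lagrange's identity. It confines the real part `e`
  -- of the product between cos(α + β) and cos(α - β).
  have hcs : |b * b' + c * c' + d * d'| ≤ Real.sin α * Real.sin β := by
    apply abs_le_of_sq_le_sq _ hss
    rw [mul_pow, hsα, hsβ]
    nlinarith [sq_nonneg (b * c' - c * b'), sq_nonneg (b * d' - d * b'),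
      sq_nonneg (c * d' - d * c')]
  obtain ⟨hcs1, hcs2⟩ := abs_le.1 hcs
  have hle : e ≤ Real.cos (|α - β|) := by
    rw [Real.cos_abs, Real.cos_sub, hcα, hcβ]; linarith
  have hge : Real.cos (α + β) ≤ e := by
    rw [Real.cos_add, hcα, hcβ]; linarith
  have h1 : |α - β| ≤ Real.arccos e := by
    rw [← Real.arccos_cos (abs_nonneg (α - β)) (abs_le.2 ⟨by linarith, by linarith⟩)]
    exact Real.arccos_le_arccos hle
  have hup : Real.arccos e ≤ α + β := by
    rcases le_total (α + β) Real.pi with hle | hle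
    · rw [← Real.arccos_cos (by linarith : 0 ≤ α + β) hle]
      exact Real.arccos_le_arccos hge
    · exact (Real.arccos_le_pi _).trans hle
  have hup' : Real.arccos e ≤ 2 * Real.pi - (α + β) := by
    rcases le_total Real.pi (α + β) with hle | hle
    · rw [← Real.arccos_cos (by linarith : 0 ≤ 2 * Real.pi - (α + β)) (by linarith),
        Real.cos_two_pi_sub]
      exact Real.arccos_le_arccos hge
    · exact (Real.arccos_le_pi _).trans (by linarith)
  have hπ := Real.pi_pos
  refine ⟨?_, le_min ?_ ?_⟩
  · rw [← sub_div, abs_div, abs_of_pos hπ]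
    gcongr
  · rw [← add_div]
    gcongr
  · rw [div_le_iff₀ hπ]
    have e1 : (2 - α / Real.pi - β / Real.pi) * Real.pi = 2 * Real.pi - (α + β) := by
      field_simp
      ring
    rwa [e1]

theorem exists_angle_eq_of_mem_tetrahedron {t : Fin 3 → ℝ} (ht : t ∈ tetrahedron) :
    ∃ f : Fin 3 → SU2, f 0 * f 1 * f 2 = 1 ∧ ∀ k, angle (f k) = t k := by
  obtain ⟨hb, hl, hu⟩ := ht
  have hπ := Real.pi_pos
  have key : ∀ k, 0 ≤ t k * Real.pi ∧ t k * Real.pi ≤ Real.pi := fun k =>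
    ⟨mul_nonneg (hb k).1 hπ.le, mul_le_of_le_one_left hπ.le (hb k).2⟩
  set α := t 0 * Real.pi with hα
  set β := t 1 * Real.pi with hβ
  set γ := t 2 * Real.pi
  have hl' : |α - β| ≤ γ := by
    rw [hα, hβ, ← sub_mul, abs_mul, abs_of_pos hπ]
    exact mul_le_mul_of_nonneg_right hl hπ.le
  have hu1 : γ ≤ α + β := by
    rw [hα, hβ, ← add_mul]
    exact mul_le_mul_of_nonneg_right (hu.trans (min_le_left _ _)) hπ.le
  have hu2 : γ ≤ 2 * Real.pi - (α + β) := by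
    have := mul_le_mul_of_nonneg_right (hu.trans (min_le_right _ _)) hπ.le
    linarith
  have hγ0 := (key 2).1
  have hγπ := (key 2).2
  have hle : Real.cos γ ≤ Real.cos (α - β) := by
    rw [← Real.cos_abs (α - β)]
    exact Real.cos_le_cos_of_nonneg_of_le_pi (abs_nonneg _) hγπ hl'
  have hge : Real.cos (α + β) ≤ Real.cos γ := by
    rcases le_total (α + β) Real.pi with h | h
    · exact Real.cos_le_cos_of_nonneg_of_le_pi hγ0 h hu1
    · rw [← Real.cos_two_pi_sub (α + β)]
      exact Real.cos_le_cos_of_nonneg_of_le_pi hγ0 (by linarith) hu2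
  rw [Real.cos_sub] at hle
  rw [Real.cos_add] at hge
  have hss : 0 ≤ Real.sin α * Real.sin β :=
    mul_nonneg (Real.sin_nonneg_of_nonneg_of_le_pi (key 0).1 (key 0).2)
      (Real.sin_nonneg_of_nonneg_of_le_pi (key 1).1 (key 1).2)
  have habs : |Real.cos α * Real.cos β - Real.cos γ| ≤ Real.sin α * Real.sin β :=
    abs_le.2 ⟨by linarith, by linarith⟩
  -- Here `u` is the cosine of the angle between the two rotation axes; it tunes the real part of
  -- the product to cos γ. If sin α sin β = 0, the axes do not matter and `u = 0` will do.
  obtain ⟨u, hu, hu'⟩ : ∃ u : ℝ, |u| ≤ 1 ∧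
      Real.cos γ = Real.cos α * Real.cos β - Real.sin α * Real.sin β * u := by
    rcases hss.eq_or_lt with h0 | h0
    · refine ⟨0, by simp, ?_⟩
      rw [← h0] at habs
      linarith [abs_nonpos_iff.1 habs]
    · refine ⟨(Real.cos α * Real.cos β - Real.cos γ) / (Real.sin α * Real.sin β), ?_, ?_⟩
      · rw [abs_div, abs_of_pos h0]
        exact div_le_one_of_le₀ habs hss
      · rw [mul_div_cancel₀ _ h0.ne']
        ring
  have hv : √(1 - u ^ 2) ^ 2 = 1 - u ^ 2 :=
    Real.sq_sqrt (by nlinarith [sq_abs u, abs_nonneg u])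
  have hA : Real.cos α ^ 2 + Real.sin α ^ 2 + (0 : ℝ) ^ 2 + (0 : ℝ) ^ 2 = 1 := by
    simp
  have hB : Real.cos β ^ 2 + (Real.sin β * u) ^ 2 + (Real.sin β * √(1 - u ^ 2)) ^ 2 +
      (0 : ℝ) ^ 2 = 1 := by
    linear_combination Real.sin β ^ 2 * hv + Real.sin_sq_add_cos_sq β
  have hcancel : ∀ k, t k * Real.pi / Real.pi = t k := fun k => mul_div_cancel_right₀ _ hπ.ne'
  refine ⟨![quat _ _ _ _ hA, quat _ _ _ _ hB, (quat _ _ _ _ hA * quat _ _ _ _ hB)⁻¹],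
    by simp, fun k => ?_⟩
  fin_cases k
  · change angle (quat _ _ _ _ hA) = t 0
    rw [angle_quat, Real.arccos_cos (key 0).1 (key 0).2, hcancel]
  · change angle (quat _ _ _ _ hB) = t 1
    rw [angle_quat, Real.arccos_cos (key 1).1 (key 1).2, hcancel]
  · change angle (quat _ _ _ _ hA * quat _ _ _ _ hB)⁻¹ = t 2
    have he : Real.cos α * Real.cos β - Real.sin α * (Real.sin β * u) -
        0 * (Real.sin β * √(1 - u ^ 2)) - 0 * 0 = Real.cos γ := by
      rw [hu']; ring
    rw [angle_inv, quat_mul, angle_quat, he, Real.arccos_cos hγ0 hγπ, hcancel]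

/-! ### Representations of surface groups -/

section Surface

variable {V : Type} {Γ : TrivalentGraph V} {T : Set (V × Fin 3)}

theorem angle_meridian_mem_tetrahedron (ρ : SurfaceGroup Γ T →* SU2) (v : V) :
    (fun k => angle (ρ (meridian Γ T (v, k)))) ∈ tetrahedron := by
  apply angle_mem_tetrahedron (f := fun k => ρ (meridian Γ T (v, k)))
  rw [← map_mul, ← map_mul, ← map_one ρ]
  exact congrArg ρ (PresentedGroup.one_of_mem (rels := {r | SurfaceRel Γ T r})
    (SurfaceRel.trinion v))

theorem angle_meridian_opp (ρ : SurfaceGroup Γ T →* SU2) (h : V × Fin 3) :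
    angle (ρ (meridian Γ T (Γ.opp h))) = angle (ρ (meridian Γ T h)) := by
  have hrel : meridian Γ T h * (PresentedGroup.of (SurfaceGen.cross h) *
      meridian Γ T (Γ.opp h) * (PresentedGroup.of (SurfaceGen.cross h))⁻¹) = 1 :=
    PresentedGroup.one_of_mem (rels := {r | SurfaceRel Γ T r}) (SurfaceRel.glue h)
  rw [eq_inv_of_mul_eq_one_left hrel, map_inv, angle_inv, map_mul, map_mul, map_inv, angle_conj]

/-- Trinion representations `A`, glued by `X`, give a representation of the surface group
after a change `g` of trivializations which makes `X` trivial along the tree. -/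
theorem exists_rep_of_gluing (A X : V × Fin 3 → SU2) (g : V → SU2)
    (hA : ∀ v, A (v, 0) * A (v, 1) * A (v, 2) = 1)
    (hX : ∀ h, X h * X (Γ.opp h) = 1)
    (hAX : ∀ h, A h * (X h * A (Γ.opp h) * (X h)⁻¹) = 1)
    (hT : ∀ h ∈ T, g h.1 * X h * (g (Γ.opp h).1)⁻¹ = 1) :
    ∃ ρ : SurfaceGroup Γ T →* SU2, ∀ h, angle (ρ (meridian Γ T h)) = angle (A h) := by
  let f : SurfaceGen V → SU2
    | .bdry h => g h.1 * A h * (g h.1)⁻¹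
    | .cross h => g h.1 * X h * (g (Γ.opp h).1)⁻¹
  have hf : ∀ r ∈ {r | SurfaceRel Γ T r}, FreeGroup.lift f r = 1 := by
    rintro r (v | h | h | ⟨h, hh⟩)
    · simp only [map_mul, FreeGroup.lift_apply_of, f]
      calc _ = g v * (A (v, 0) * A (v, 1) * A (v, 2)) * (g v)⁻¹ := by group
        _ = 1 := by rw [hA]; simp
    · simp only [map_mul, FreeGroup.lift_apply_of, f, Γ.opp_opp]
      calc _ = g h.1 * (X h * X (Γ.opp h)) * (g h.1)⁻¹ := by group
        _ = 1 := by rw [hX]; simp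
    · simp only [map_mul, map_inv, FreeGroup.lift_apply_of, f]
      calc _ = g h.1 * (A h * (X h * A (Γ.opp h) * (X h)⁻¹)) * (g h.1)⁻¹ := by group
        _ = 1 := by rw [hAX]; simp
    · simpa only [FreeGroup.lift_apply_of, f] using hT h hh
  refine ⟨PresentedGroup.toGroup hf, fun h => ?_⟩
  rw [meridian, PresentedGroup.toGroup.of]
  exact angle_conj _ _

end Surface

/-! ### The graph `3Θ` -/

theorem exists_rep_of_labelling {p : Vert → Fin 3 → ℝ} (hp : ∀ v, p v ∈ tetrahedron)
    (hopp : ∀ h : Vert × Fin 3, p (threeTheta.opp h).1 (threeTheta.opp h).2 = p h.1 h.2) :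
    ∃ ρ : SurfaceGroup threeTheta thetaTree →* SU2,
      ∀ h : Vert × Fin 3, angle (ρ (meridian threeTheta thetaTree h)) = p h.1 h.2 := by
  choose A hA hAp using fun v => exists_angle_eq_of_mem_tetrahedron (hp v)
  -- The inverse reflects the opposite orientations induced on the common circle.
  have hconj : ∀ h : Vert × Fin 3, ∃ Y : SU2,
      A h.1 h.2 = Y * (A (threeTheta.opp h).1 (threeTheta.opp h).2)⁻¹ * Y⁻¹ := fun h =>
    exists_conj_of_angle_eq (by rw [angle_inv, hAp, hAp, hopp])
  choose Y hY using hconj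
  -- The choices of `Y` at the two ends of an edge are unrelated. Each edge has exactly one end in
  -- `vplus`, so keeping `Y` there and its inverse at the other end makes `X` consistent.
  let pos : Vert × Fin 3 → Bool := fun h => h.1 = vplus 0 ∨ h.1 = vplus 1
  have hpos : ∀ h, pos (threeTheta.opp h) = !pos h := by
    unfold pos vplus threeTheta
    decide
  let X : Vert × Fin 3 → SU2 := fun h => if pos h then Y h else (Y (threeTheta.opp h))⁻¹
  have hX : ∀ h, X h * X (threeTheta.opp h) = 1 := by
    intro h
    simp only [X, hpos, threeTheta.opp_opp]
    cases pos h <;> simp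
  have hAX : ∀ h, A h.1 h.2 *
      (X h * A (threeTheta.opp h).1 (threeTheta.opp h).2 * (X h)⁻¹) = 1 := by
    intro h
    cases hh : pos h
    · have := hY (threeTheta.opp h)
      rw [threeTheta.opp_opp] at this
      simp only [X, hh, this]
      simp [mul_assoc]
    · simp only [X, hh, if_true]
      rw [hY h]
      group
  -- The product of `X` along the tree path from the top left vertex.
  let g : Vert → SU2
    | (false, 0) => 1
    | (true, 0) => X ((false, 0), 1)
    | (false, 1) => X ((false, 0), 2)
    | (true, 1) => X ((false, 0), 2) * X ((false, 1), 1)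
  have hX' : ∀ h, X (threeTheta.opp h) = (X h)⁻¹ := fun h => eq_inv_of_mul_eq_one_right (hX h)
  have h1 : X ((true, 0), 1) = (X ((false, 0), 1))⁻¹ := hX' ((false, 0), 1)
  have h2 : X ((true, 1), 1) = (X ((false, 1), 1))⁻¹ := hX' ((false, 1), 1)
  have h3 : X ((false, 1), 2) = (X ((false, 0), 2))⁻¹ := hX' ((false, 0), 2)
  obtain ⟨ρ, hρ⟩ := exists_rep_of_gluing (T := thetaTree) (fun h => A h.1 h.2) X g hA hX hAX (by
    rintro ⟨⟨s, i⟩, k⟩ (hk | ⟨hs, hk⟩)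
    · simp only at hk
      subst hk
      cases s <;> fin_cases i <;> simp [threeTheta, thetaOpp, g, h1, h2]
    · simp only at hs hk
      subst hs hk
      fin_cases i <;> simp [threeTheta, thetaOpp, g, h3])
  exact ⟨ρ, fun h => (hρ h).trans (hAp _ _)⟩

theorem mem_momentPolytope_iff {t : Fin 2 → Fin 3 → ℝ} :
    t ∈ momentPolytope ↔ GluingConstraints t := by
  constructor
  · rintro ⟨c, rfl⟩
    induction c using Quotient.inductionOn with | _ ρ
    exact ⟨fun v k => angle (ρ (meridian threeTheta thetaTree (v, k))),
      angle_meridian_mem_tetrahedron ρ, angle_meridian_opp ρ, fun _ => rfl⟩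
  · rintro ⟨p, hp, hopp, ht⟩
    obtain ⟨ρ, hρ⟩ := exists_rep_of_labelling hp hopp
    refine ⟨Quotient.mk (conjSetoid _) ρ, ?_⟩
    funext i k
    rw [← ht]
    exact hρ (vplus i, k)

/-- Every edge meets `vplus`, so the labelling `p` is forced by `t`. Each remaining vertex takes its
first two coordinates from one `t i` and its third from the other. -/
theorem gluingConstraints_iff {t : Fin 2 → Fin 3 → ℝ} (ht : t ∈ tetrahedronSq) :
    GluingConstraints t ↔ CrossedInequalities t := by
  constructor
  · rintro ⟨p, hp, hopp, hpt⟩ i j hij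
    have h0 : p (false, 0) = t 0 := hpt 0
    have h1 : p (true, 1) = t 1 := hpt 1
    have hij' : (i = 0 ∧ j = 1) ∨ (i = 1 ∧ j = 0) := by omega
    rcases hij' with ⟨rfl, rfl⟩ | ⟨rfl, rfl⟩
    · have e0 : p (true, 0) 0 = p (false, 0) 0 := hopp ((false, 0), 0)
      have e1 : p (true, 0) 1 = p (false, 0) 1 := hopp ((false, 0), 1)
      have e2 : p (true, 0) 2 = p (true, 1) 2 := hopp ((true, 1), 2)
      have := (hp (true, 0)).2
      rwa [e0, e1, e2, h0, h1] at this
    · have e0 : p (false, 1) 0 = p (true, 1) 0 := hopp ((true, 1), 0)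
      have e1 : p (false, 1) 1 = p (true, 1) 1 := hopp ((true, 1), 1)
      have e2 : p (false, 1) 2 = p (false, 0) 2 := hopp ((false, 0), 2)
      have := (hp (false, 1)).2
      rwa [e0, e1, e2, h0, h1] at this
  · intro hc
    have hmem : ∀ i j : Fin 2, i ≠ j → ![t i 0, t i 1, t j 2] ∈ tetrahedron := by
      intro i j hij
      -- The bounds 0 and 1 are inherited from the given tetrahedra; only the remaining inequalities
      -- use `hc`.
      refine ⟨fun k => ?_, hc i j hij⟩
      fin_cases k
      exacts [(ht i).1 0, (ht i).1 1, (ht j).1 2]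
    let p : Vert → Fin 3 → ℝ
      | (false, 0) => t 0
      | (true, 0) => ![t 0 0, t 0 1, t 1 2]
      | (false, 1) => ![t 1 0, t 1 1, t 0 2]
      | (true, 1) => t 1
    refine ⟨p, ?_, ?_, ?_⟩
    · rintro ⟨s, i⟩
      cases s <;> fin_cases i
      exacts [ht 0, hmem 1 0 (by decide), hmem 0 1 (by decide), ht 1]
    · rintro ⟨⟨s, i⟩, k⟩
      cases s <;> fin_cases i <;> fin_cases k <;> rfl
    · intro i
      fin_cases i <;> rfl

theorem momentPolytope_subset : momentPolytope ⊆ tetrahedronSq := by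
  intro t ht i
  obtain ⟨p, hp, -, hpt⟩ := mem_momentPolytope_iff.1 ht
  exact hpt i ▸ hp (vplus i)

end Delzant

theorem mainTheorem6 :
    Delzant.momentPolytope ⊆ Delzant.tetrahedronSq ∧
    ∀ t ∈ Delzant.tetrahedronSq,
      (t ∈ Delzant.momentPolytope ↔ Delzant.CrossedInequalities t) ∧
      (Delzant.GluingConstraints t ↔ Delzant.CrossedInequalities t) :=
  ⟨Delzant.momentPolytope_subset, fun _ ht =>
    ⟨Delzant.mem_momentPolytope_iff.trans (Delzant.gluingConstraints_iff ht),
      Delzant.gluingConstraints_iff ht⟩⟩
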